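/- Let $m \ge 2$, let $D \subset \mathbb{R}^m$ be a bounded domain (a bounded, non-empty, connected open set), let $\mu > 0$, and let $u : D \to \mathbb{R}$ be continuous. Let $|E|$ denote the volume of $E$, $B_r(x)$ the open ball of radius $r$ centred at $x$, $S_r(x)$ its boundary sphere, and $A_x(r_1,r_2) = \{ y \in \mathbb{R}^m : r_1 < |x-y| < r_2 \}$. Write $$M^\bullet(A,u) = \frac{1}{|A|}\int_A u(y)\,dy, \qquad M^\circ(S_r(x),u) = \frac{1}{\omega_m}\int_{S_1(0)} u(x+ry)\,dS_y ,$$ where $dS$ is the surface measure and $\omega_m$ is the area of the unit sphere $S_1(0)$. For $t>0$ put $$a^\circ(t) = \Gamma\!\left(\tfrac m2\right)\frac{I_{(m-2)/2}(t)}{(t/2)^{(m-2)/2}}, \qquad a^\bullet(t) = \Gamma\!\left(\tfrac m2+1\right)\frac{I_{m/2}(t)}{(t/2)^{m/2}} ,$$ where $I_\nu(t)=\sum_{k\ge 0} \frac{(t/2)^{2k+\nu}}{k!\,\Gamma(k+\nu+1)}$ is the modified Bessel function of the first kind of order $\nu$. For $x\in D$, $0<r_1<r_2$ with $\overline{B_{r_2}(x)}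 \subset D$, and $r \in [r_1,r_2]$, consider the identity $$M^\bullet(A_x(r_1,r_2),u) = \frac{a^\bullet(\mu r_2)\,|B_{r_2}(x)| - a^\bullet(\mu r_1)\,|B_{r_1}(x)|}{a^\circ(\mu r)\,|A_x(r_1,r_2)|}\; M^\circ(S_r(x),u). \tag{$*$}$$ Suppose that for every $x \in D$ and all $r_2>r_1>0$ with $\overline{B_{r_2}(x)}\subset D$ at least one of the following holds: (i) $(*)$ holds for every $r\in(r_1,r_2)$; (ii) $(*)$ holds for $r=r_1$; (iii) $(*)$ holds for $r=r_2$. (In particular, this is so if one and the same of (i), (ii), (iii) holds for all such $x,r_1,r_2$.) Then $u$ is $\mu$-panharmonic in $D$, that is, $u\in C^2(D)$ and $\Delta u = \mu^2 u$ in $D$. -/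

import Mathlib

/-- The modified Bessel function of the first kind,
`I_ν(z) = ∑ₖ (z/2)^(2k+ν) / (k! Γ(k+ν+1))`, for real order `ν` and real argument `z > 0`
(the only arguments at which it is used). -/
noncomputable def besselI (ν z : ℝ) : ℝ :=
  ∑' k : ℕ, (z / 2) ^ (2 * (k : ℝ) + ν) / ((k.factorial : ℝ) * Real.Gamma ((k : ℝ) + ν + 1))

/-- The coefficient `a°(t) = Γ(m/2) I_{(m-2)/2}(t) / (t/2)^{(m-2)/2}`, for `t > 0`. -/
noncomputable def aCirc (m : ℕ) (t : ℝ) : ℝ :=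
  Real.Gamma ((m : ℝ) / 2) *
    (besselI (((m : ℝ) - 2) / 2) t / (t / 2) ^ (((m : ℝ) - 2) / 2))

/-- The coefficient `a•(t) = Γ(m/2 + 1) I_{m/2}(t) / (t/2)^{m/2}`, for `t > 0`. -/
noncomputable def aBullet (m : ℕ) (t : ℝ) : ℝ :=
  Real.Gamma ((m : ℝ) / 2 + 1) * (besselI ((m : ℝ) / 2) t / (t / 2) ^ ((m : ℝ) / 2))

/-- The open annulus `A_x(r₁, r₂) = {y : r₁ < |x - y| < r₂}`. -/
def annulus {m : ℕ} (x : EuclideanSpace ℝ (Fin m)) (r₁ r₂ : ℝ) :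
    Set (EuclideanSpace ℝ (Fin m)) :=
  {y | r₁ < ‖x - y‖ ∧ ‖x - y‖ < r₂}

/-- The ball `B_r(x)` is admissible with respect to `D` if its closure lies in `D`. -/
def AdmissibleBall {m : ℕ} (D : Set (EuclideanSpace ℝ (Fin m)))
    (x : EuclideanSpace ℝ (Fin m)) (r : ℝ) : Prop :=
  closure (Metric.ball x r) ⊆ D

/-- The volume mean `M•(A, u) = |A|⁻¹ ∫_A u(y) dy`. -/
noncomputable def volumeMean {m : ℕ} (A : Set (EuclideanSpace ℝ (Fin m)))
    (u : EuclideanSpace ℝ (Fin m) → ℝ) : ℝ :=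
  (MeasureTheory.volume.real A)⁻¹ * ∫ y in A, u y

/-- The spherical mean `M°(S_r(x), u) = ω_m⁻¹ ∫_{S_1(0)} u(x + r y) dS_y`, where `dS` is the
surface measure on the unit sphere and `ω_m` its total mass. -/
noncomputable def sphericalMean {m : ℕ} (x : EuclideanSpace ℝ (Fin m)) (r : ℝ)
    (u : EuclideanSpace ℝ (Fin m) → ℝ) : ℝ :=
  ((MeasureTheory.volume : MeasureTheory.Measure (EuclideanSpace ℝ (Fin m))).toSphere.real
      Set.univ)⁻¹ *
    ∫ y : Metric.sphere (0 : EuclideanSpace ℝ (Fin m)) 1,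
      u (x + r • (y : EuclideanSpace ℝ (Fin m)))
      ∂(MeasureTheory.volume : MeasureTheory.Measure (EuclideanSpace ℝ (Fin m))).toSphere

/-- The annular quadrature identity for the annulus `A_x(r₁, r₂)` and the sphere `S_r(x)`. -/
def AnnularIdentity {m : ℕ} (μ : ℝ) (u : EuclideanSpace ℝ (Fin m) → ℝ)
    (x : EuclideanSpace ℝ (Fin m)) (r₁ r₂ r : ℝ) : Prop :=
  volumeMean (annulus x r₁ r₂) u =
    (aBullet m (μ * r₂) * MeasureTheory.volume.real (Metric.ball x r₂) -
        aBullet m (μ * r₁) * MeasureTheory.volume.real (Metric.ball x r₁)) /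
      (aCirc m (μ * r) * MeasureTheory.volume.real (annulus x r₁ r₂)) *
    sphericalMean x r u

/-- `u` is `μ`-panharmonic in the open set `D`: a `C²` solution of `Δu - μ² u = 0` there. -/
def PanharmonicOn {m : ℕ} (μ : ℝ) (u : EuclideanSpace ℝ (Fin m) → ℝ)
    (D : Set (EuclideanSpace ℝ (Fin m))) : Prop :=
  ContDiffOn ℝ 2 u D ∧ ∀ x ∈ D, Laplacian.laplacian u x - μ ^ 2 * u x = 0

/-! Fix x and put q(r) = M°(S_r(x), u) / a°(μr). Termwise integration of the Bessel series gives
a•(μr)|B_r| = ω_m ∫₀^r s^(m-1) a°(μs) ds (`integral_pow_mul_hypLimit`). In polar coordinates (*)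
therefore says that the mean of q over [r₁, r₂], with the positive weight s^(m-1) a°(μs), equals
q(r) (`AnnularIdentity.integral_eq`). Alternative (i) implies (ii) by continuity, so this mean is
always an endpoint value. If q differed at two radii, some subinterval would have q strictly between
its endpoint values throughout the interior, and the mean there would be neither of them. Hence q is
constant, and r → 0 gives M°(S_r(x), u) = u(x) a°(μr) (`sphericalMean_eq_of_annular`).

By this mean value property u is locally a constant multiple of its convolution with a smooth radial
bump, hence C² (`contDiffAt_of_sphericalMean`). Comparing the second-order expansions of u and a°
over small balls then yields Δu = μ²u (`laplacian_eq_of_sphericalMean`). -/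

/-! ### The Bessel coefficients as values of ₀F₁. -/

section BesselSeries

/-- The coefficients `Γ(c) / (k! Γ(k + c))` of the confluent hypergeometric limit function. -/
noncomputable def hypCoeff (c : ℝ) (k : ℕ) : ℝ :=
  Real.Gamma c / ((k.factorial : ℝ) * Real.Gamma ((k : ℝ) + c))

/-- The confluent hypergeometric limit function `₀F₁(; c; z)`. -/
noncomputable def hypLimit (c z : ℝ) : ℝ := ∑' k : ℕ, hypCoeff c k * z ^ k

theorem hypCoeff_pos {c : ℝ} (hc : 0 < c) (k : ℕ) : 0 < hypCoeff c k := by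
  have := Real.Gamma_pos_of_pos hc
  have := Real.Gamma_pos_of_pos (by positivity : 0 < (k : ℝ) + c)
  unfold hypCoeff
  positivity

theorem hypCoeff_zero {c : ℝ} (hc : 0 < c) : hypCoeff c 0 = 1 := by
  have := (Real.Gamma_pos_of_pos hc).ne'
  simp [hypCoeff, this]

theorem hypCoeff_one {c : ℝ} (hc : 0 < c) : hypCoeff c 1 = 1 / c := by
  have := (Real.Gamma_pos_of_pos hc).ne'
  simp only [hypCoeff, Nat.factorial_one, Nat.cast_one, one_mul]
  rw [add_comm, Real.Gamma_add_one hc.ne']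
  field_simp

theorem Gamma_le_Gamma_nat_add {c : ℝ} (hc : 1 ≤ c) (k : ℕ) :
    Real.Gamma c ≤ Real.Gamma ((k : ℝ) + c) := by
  induction k with
  | zero => simp
  | succ k ih =>
    have hk : 0 < (k : ℝ) + c := by positivity
    have h1 : ((k + 1 : ℕ) : ℝ) + c = ((k : ℝ) + c) + 1 := by push_cast; ring
    rw [h1, Real.Gamma_add_one hk.ne']
    have := Real.Gamma_pos_of_pos hk
    have hk0 : (0 : ℝ) ≤ k := by positivity
    nlinarith

/-- For c ≥ 1 the Gamma quotient is at most 1, so the exponential series dominates ₀F₁. -/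
theorem hypCoeff_le {c : ℝ} (hc : 1 ≤ c) (k : ℕ) : hypCoeff c k ≤ 1 / (k.factorial : ℝ) := by
  have h0 := Real.Gamma_pos_of_pos (by positivity : 0 < c)
  have h1 := Real.Gamma_pos_of_pos (by positivity : 0 < (k : ℝ) + c)
  have hk : (0 : ℝ) < k.factorial := by positivity
  unfold hypCoeff
  rw [div_le_div_iff₀ (by positivity) hk]
  nlinarith [Gamma_le_Gamma_nat_add hc k]

/-- With c = m/2 this links the series of a• to that of a°. -/
theorem hypCoeff_add_one {c : ℝ} (hc : 0 < c) (k : ℕ) :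
    hypCoeff (c + 1) k * ((k : ℝ) + c) = c * hypCoeff c k := by
  have hk : 0 < (k : ℝ) + c := by positivity
  have h0 := (Real.Gamma_pos_of_pos hk).ne'
  unfold hypCoeff
  rw [Real.Gamma_add_one hc.ne', ← add_assoc, Real.Gamma_add_one hk.ne']
  field_simp

theorem norm_hypCoeff_mul_pow_le {c : ℝ} (hc : 1 ≤ c) {z R : ℝ} (hz : |z| ≤ R) (k : ℕ) :
    ‖hypCoeff c k * z ^ k‖ ≤ R ^ k / (k.factorial : ℝ) := by
  rw [norm_mul, norm_pow, Real.norm_eq_abs, Real.norm_eq_abs,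
    abs_of_pos (hypCoeff_pos (by positivity) k)]
  calc hypCoeff c k * |z| ^ k ≤ 1 / (k.factorial : ℝ) * R ^ k := by
        gcongr
        exact hypCoeff_le hc k
    _ = _ := by ring

theorem summable_hypLimit {c : ℝ} (hc : 1 ≤ c) (z : ℝ) :
    Summable fun k : ℕ => hypCoeff c k * z ^ k :=
  (Real.summable_pow_div_factorial |z|).of_norm_bounded
    fun k => norm_hypCoeff_mul_pow_le hc le_rfl k

theorem continuous_hypLimit {c : ℝ} (hc : 1 ≤ c) : Continuous (hypLimit c) := by
  rw [continuous_iff_continuousAt]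
  intro z
  have : ContinuousOn (hypLimit c) (Metric.ball 0 (|z| + 1)) := by
    refine continuousOn_tsum (fun k => by fun_prop)
      (Real.summable_pow_div_factorial (|z| + 1)) fun k w hw => ?_
    refine norm_hypCoeff_mul_pow_le hc ?_ k
    have : |w| < |z| + 1 := by simpa using hw
    exact this.le
  exact this.continuousAt (Metric.isOpen_ball.mem_nhds (by simp))

theorem one_le_hypLimit {c : ℝ} (hc : 1 ≤ c) {z : ℝ} (hz : 0 ≤ z) : 1 ≤ hypLimit c z := by
  have h := (summable_hypLimit hc z).le_tsum 0 fun k _ =>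
    mul_nonneg (hypCoeff_pos (by positivity) k).le (pow_nonneg hz k)
  rw [hypCoeff_zero (by positivity : 0 < c), pow_zero, mul_one] at h
  exact h

theorem hypLimit_zero {c : ℝ} (hc : 1 ≤ c) : hypLimit c 0 = 1 := by
  unfold hypLimit
  rw [tsum_eq_single 0 (by intro k hk; simp [hk])]
  simp [hypCoeff_zero (by positivity : 0 < c)]

theorem abs_hypLimit_sub_le {c : ℝ} (hc : 1 ≤ c) {z : ℝ} (hz : 0 ≤ z) (hz1 : z ≤ 1) :
    |hypLimit c z - 1 - z / c| ≤ Real.exp 1 * z ^ 2 := by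
  have hs := summable_hypLimit hc z
  have hc0 : 0 < c := by positivity
  have hsplit := hs.sum_add_tsum_nat_add 2
  rw [Finset.sum_range_succ, Finset.sum_range_one, hypCoeff_zero hc0, hypCoeff_one hc0] at hsplit
  have heq : hypLimit c z - 1 - z / c = ∑' k : ℕ, hypCoeff c (k + 2) * z ^ (k + 2) := by
    unfold hypLimit
    rw [← hsplit]
    ring
  have hexp : HasSum (fun k : ℕ => 1 / (k.factorial : ℝ)) (Real.exp 1) := by
    have := NormedSpace.expSeries_div_hasSum_exp (1 : ℝ)
    simpa [Real.exp_eq_exp_ℝ] using this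
  rw [heq, ← Real.norm_eq_abs]
  -- Since z ≤ 1, each tail term is at most z²/k!, and these sum to e·z².
  refine tsum_of_norm_bounded (hexp.mul_right (z ^ 2)) fun k => ?_
  rw [norm_mul, norm_pow, Real.norm_eq_abs, Real.norm_eq_abs,
    abs_of_pos (hypCoeff_pos hc0 _), abs_of_nonneg hz]
  have h1 : hypCoeff c (k + 2) ≤ 1 / (k.factorial : ℝ) := by
    refine (hypCoeff_le hc _).trans ?_
    gcongr
    omega
  gcongr ?_ * ?_
  rw [pow_add]
  exact mul_le_of_le_one_left (by positivity) (pow_le_one₀ hz hz1)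

/-- Integrating s^(m-1+2k) produces the factor 1/(m+2k), which is what raises the parameter from m/2
to m/2 + 1. With α = μ²/4 it expresses a• as a radial integral of a°. -/
theorem integral_pow_mul_hypLimit {m : ℕ} (hm : 2 ≤ m) (α r : ℝ) :
    ∫ s in (0 : ℝ)..r, (m : ℝ) * (s ^ (m - 1) * hypLimit ((m : ℝ) / 2) (α * s ^ 2)) =
      r ^ m * hypLimit ((m : ℝ) / 2 + 1) (α * r ^ 2) := by
  have hm' : (2 : ℝ) ≤ m := by exact_mod_cast hm
  have hc : 1 ≤ (m : ℝ) / 2 := by linarith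
  let f : ℕ → C(ℝ, ℝ) := fun k =>
    ⟨fun s => (m : ℝ) * (s ^ (m - 1) * (hypCoeff ((m : ℝ) / 2) k * (α * s ^ 2) ^ k)),
      by fun_prop⟩
  have hsum : Summable fun k : ℕ =>
      ‖(f k).restrict (⟨Set.uIcc 0 r, isCompact_uIcc⟩ : TopologicalSpace.Compacts ℝ)‖ := by
    refine Summable.of_nonneg_of_le (fun k => norm_nonneg _) (fun k => ?_)
      ((Real.summable_pow_div_factorial (|α| * |r| ^ 2)).mul_left ((m : ℝ) * |r| ^ (m - 1)))
    refine (ContinuousMap.norm_le _ (by positivity)).2 ?_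
    rintro ⟨s, hs⟩
    have hs' : |s| ≤ |r| := by simpa using Set.abs_sub_left_of_mem_uIcc hs
    have h1 : |α * s ^ 2| ≤ |α| * |r| ^ 2 := by
      rw [abs_mul, abs_pow]
      gcongr
    have h2 := norm_hypCoeff_mul_pow_le hc h1 k
    change ‖(m : ℝ) * (s ^ (m - 1) * (hypCoeff ((m : ℝ) / 2) k * (α * s ^ 2) ^ k))‖ ≤ _
    rw [norm_mul, norm_mul, norm_pow, Real.norm_eq_abs s, Real.norm_natCast, ← mul_assoc]
    gcongr
  have hI := intervalIntegral.hasSum_intervalIntegral_of_summable_norm hsum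
  have hL : ∀ s : ℝ, ∑' k, f k s =
      (m : ℝ) * (s ^ (m - 1) * hypLimit ((m : ℝ) / 2) (α * s ^ 2)) := by
    intro s
    simp only [f, ContinuousMap.coe_mk, tsum_mul_left, hypLimit]
  simp only [hL] at hI
  rw [← hI.tsum_eq]
  unfold hypLimit
  rw [← tsum_mul_left]
  congr 1
  ext k
  have hpow : ∀ s : ℝ, f k s =
      ((m : ℝ) * hypCoeff ((m : ℝ) / 2) k * α ^ k) * s ^ (m - 1 + 2 * k) := by
    intro s
    simp only [f, ContinuousMap.coe_mk, mul_pow, pow_add, pow_mul]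
    ring
  simp only [hpow]
  rw [intervalIntegral.integral_const_mul, integral_pow]
  have hexp : m - 1 + 2 * k + 1 = m + 2 * k := by omega
  have hcast : (((m - 1 + 2 * k : ℕ) : ℝ) + 1) = (m : ℝ) + 2 * k := by exact_mod_cast hexp
  have h3 := hypCoeff_add_one (by positivity : 0 < (m : ℝ) / 2) k
  have hne : (m : ℝ) + 2 * k ≠ 0 := by positivity
  rw [hexp, hcast, zero_pow (by omega), sub_zero, mul_pow, ← pow_mul, pow_add]
  generalize hypCoeff ((m : ℝ) / 2 + 1) k = A at h3 ⊢
  generalize hypCoeff ((m : ℝ) / 2) k = B at h3 ⊢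
  rw [← mul_div_assoc, div_eq_iff hne]
  linear_combination (-2 : ℝ) * (r ^ m * α ^ k * r ^ (2 * k)) * h3

/-- Dividing by (t/2)^(c-1) removes the real power and leaves a power series in t²/4, which makes
sense at t = 0 too. -/
theorem hypLimit_eq_besselI {c t : ℝ} (hc : 1 ≤ c) (ht : 0 < t) :
    Real.Gamma c * (besselI (c - 1) t / (t / 2) ^ (c - 1)) = hypLimit c (t ^ 2 / 4) := by
  have ht2 : 0 < t / 2 := by positivity
  have hp : (t / 2) ^ (c - 1) ≠ 0 := (Real.rpow_pos_of_pos ht2 _).ne'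
  unfold besselI hypLimit
  rw [← tsum_div_const, ← tsum_mul_left]
  congr 1
  ext k
  have h1 : (k : ℝ) + (c - 1) + 1 = k + c := by ring
  have h2 : (t / 2) ^ (2 * (k : ℝ)) = (t ^ 2 / 4) ^ k := by
    rw [show (2 * (k : ℝ)) = ((2 * k : ℕ) : ℝ) by push_cast; ring, Real.rpow_natCast, pow_mul]
    congr 1
    ring
  rw [h1, Real.rpow_add ht2, h2, hypCoeff]
  field_simp

theorem aCirc_eq_hypLimit {m : ℕ} (hm : 2 ≤ m) {t : ℝ} (ht : 0 < t) :
    aCirc m t = hypLimit ((m : ℝ) / 2) (t ^ 2 / 4) := by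
  have hm' : (2 : ℝ) ≤ m := by exact_mod_cast hm
  rw [← hypLimit_eq_besselI (by linarith) ht, aCirc]
  congr 4 <;> ring

theorem aBullet_eq_hypLimit {m : ℕ} {t : ℝ} (ht : 0 < t) :
    aBullet m t = hypLimit ((m : ℝ) / 2 + 1) (t ^ 2 / 4) := by
  rw [← hypLimit_eq_besselI (by linarith [(by positivity : (0 : ℝ) ≤ (m : ℝ) / 2)]) ht, aBullet]
  congr 4 <;> ring

end BesselSeries

/-! ### Weighted means attained at endpoints. -/

section WeightedMeans

open Set

theorem const_mul_integral_lt_integral_mul {q w : ℝ → ℝ} {a b : ℝ} (hab : a < b)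
    (hq : ContinuousOn q (Icc a b)) (hw : ContinuousOn w (Icc a b))
    (hw0 : ∀ s ∈ Icc a b, 0 < w s) {c : ℝ} (hc : ∀ s ∈ Ioo a b, c < q s) :
    c * ∫ s in a..b, w s < ∫ s in a..b, w s * q s := by
  have hwi : IntervalIntegrable w MeasureTheory.volume a b :=
    hw.intervalIntegrable_of_Icc hab.le
  have hwq : IntervalIntegrable (fun s => w s * q s) MeasureTheory.volume a b :=
    (hw.mul hq).intervalIntegrable_of_Icc hab.le
  have h := intervalIntegral.intervalIntegral_pos_of_pos_on
    (f := fun s => w s * q s - c * w s) (hwq.sub (hwi.const_mul c)) (fun s hs => ?_) hab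
  · rw [intervalIntegral.integral_sub hwq (hwi.const_mul c),
      intervalIntegral.integral_const_mul] at h
    linarith
  · nlinarith [hw0 s (Ioo_subset_Icc_self hs), hc s hs]

/-- If `q a < q b` then some subinterval `[r₁, r₂]` has `q r₁ < q s < q r₂` in its interior. -/
theorem exists_subinterval_between {q : ℝ → ℝ} {a b : ℝ} (hab : a ≤ b)
    (hq : ContinuousOn q (Icc a b)) (hlt : q a < q b) :
    ∃ r₁ r₂, a ≤ r₁ ∧ r₁ < r₂ ∧ r₂ ≤ b ∧ ∀ s ∈ Ioo r₁ r₂, q r₁ < q s ∧ q s < q r₂ := by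
  -- r₁ is the last point of [a, b] at which q ≤ q a.
  have hS : IsCompact (Icc a b ∩ q ⁻¹' Iic (q a)) :=
    isCompact_Icc.of_isClosed_subset (hq.preimage_isClosed_of_isClosed isClosed_Icc isClosed_Iic)
      inter_subset_left
  obtain ⟨r₁, ⟨⟨har, hrb⟩, hr1⟩, hmax⟩ :=
    hS.exists_isGreatest ⟨a, left_mem_Icc.2 hab, le_refl (q a)⟩
  have hr1' : q r₁ ≤ q a := hr1
  have hq' : ContinuousOn q (Icc r₁ b) := hq.mono (Icc_subset_Icc_left har)
  -- r₂ is the first point after r₁ at which q ≥ q b.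
  have hT : IsCompact (Icc r₁ b ∩ q ⁻¹' Ici (q b)) :=
    isCompact_Icc.of_isClosed_subset (hq'.preimage_isClosed_of_isClosed isClosed_Icc isClosed_Ici)
      inter_subset_left
  obtain ⟨r₂, ⟨⟨hr12, hr2b⟩, hr2⟩, hmin⟩ :=
    hT.exists_isLeast ⟨b, right_mem_Icc.2 hrb, le_refl (q b)⟩
  have hr2' : q b ≤ q r₂ := hr2
  refine ⟨r₁, r₂, har, lt_of_le_of_ne hr12 ?_, hr2b, fun s hs => ⟨?_, ?_⟩⟩
  · rintro rfl
    linarith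
  · by_contra! hcon
    have := hmax ⟨⟨har.trans hs.1.le, hs.2.le.trans hr2b⟩, mem_Iic.2 (hcon.trans hr1')⟩
    exact absurd hs.1 (not_lt.2 this)
  · by_contra! hcon
    have := hmin ⟨⟨hs.1.le, hs.2.le.trans hr2b⟩, mem_Ici.2 (hr2'.trans hcon)⟩
    exact absurd hs.2 (not_lt.2 this)

/-- On the subinterval from `exists_subinterval_between` the mean lies strictly between both
endpoint values, so it does not matter which endpoint the hypothesis selects. -/
theorem not_lt_of_weighted_mean_eq {q w : ℝ → ℝ} {a b : ℝ} (hab : a ≤ b)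
    (hq : ContinuousOn q (Icc a b)) (hw : ContinuousOn w (Icc a b))
    (hw0 : ∀ s ∈ Icc a b, 0 < w s)
    (h : ∀ r₁ r₂, a ≤ r₁ → r₁ < r₂ → r₂ ≤ b →
      ∃ r ∈ ({r₁, r₂} : Set ℝ), ∫ s in r₁..r₂, w s * q s = q r * ∫ s in r₁..r₂, w s) :
    ¬ q a < q b := by
  intro hlt
  obtain ⟨r₁, r₂, h1, h12, h2, hbtw⟩ := exists_subinterval_between hab hq hlt
  have hsub : Icc r₁ r₂ ⊆ Icc a b := Icc_subset_Icc h1 h2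
  have hl := const_mul_integral_lt_integral_mul h12 (hq.mono hsub) (hw.mono hsub)
    (fun s hs => hw0 s (hsub hs)) fun s hs => (hbtw s hs).1
  have hr := const_mul_integral_lt_integral_mul (q := fun s => -q s) h12 (hq.mono hsub).neg (hw.mono hsub)
    (fun s hs => hw0 s (hsub hs)) (c := -q r₂) fun s hs => neg_lt_neg (hbtw s hs).2
  simp only [mul_neg, intervalIntegral.integral_neg] at hr
  obtain ⟨r, hmem, hr'⟩ := h r₁ r₂ h1 h12 h2
  rcases hmem with rfl | hmem
  · linarith
  · rw [mem_singleton_iff.1 hmem] at hr'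
    linarith

/-- A continuous function whose weighted mean over each subinterval is attained at an endpoint
takes equal values at the ends of the interval. -/
theorem eq_of_weighted_mean_eq {q w : ℝ → ℝ} {a b : ℝ} (hab : a ≤ b)
    (hq : ContinuousOn q (Icc a b)) (hw : ContinuousOn w (Icc a b))
    (hw0 : ∀ s ∈ Icc a b, 0 < w s)
    (h : ∀ r₁ r₂, a ≤ r₁ → r₁ < r₂ → r₂ ≤ b →
      ∃ r ∈ ({r₁, r₂} : Set ℝ), ∫ s in r₁..r₂, w s * q s = q r * ∫ s in r₁..r₂, w s) :
    q a = q b := by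
  refine le_antisymm (not_lt.1 fun hlt => ?_)
    (not_lt.1 (not_lt_of_weighted_mean_eq hab hq hw hw0 h))
  refine not_lt_of_weighted_mean_eq (q := fun s => -q s) hab hq.neg hw hw0 ?_ (neg_lt_neg hlt)
  intro r₁ r₂ h1 h12 h2
  obtain ⟨r, hr, he⟩ := h r₁ r₂ h1 h12 h2
  refine ⟨r, hr, ?_⟩
  simp only [mul_neg, intervalIntegral.integral_neg, neg_mul, he]

end WeightedMeans

/-! ### Polar coordinates and spherical means. -/

section SphericalMeans

open MeasureTheory Set Metric Module

section Polar

variable {E : Type*} [NormedAddCommGroup E] [NormedSpace ℝ E] [FiniteDimensional ℝ E]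
  [Nontrivial E] [MeasurableSpace E] [BorelSpace E]

/-- Integration in polar coordinates. -/
theorem integral_eq_integral_sphere (ν : Measure E) [ν.IsAddHaarMeasure] {f : E → ℝ}
    (hf : Integrable f ν) :
    ∫ x, f x ∂ν = ∫ s in Ioi (0 : ℝ),
      s ^ (finrank ℝ E - 1) * ∫ y : sphere (0 : E) 1, f (s • (y : E)) ∂ν.toSphere := by
  have hmp := ν.measurePreserving_homeomorphUnitSphereProd
  let F : sphere (0 : E) 1 × Ioi (0 : ℝ) → ℝ := fun p => f ((p.2 : ℝ) • (p.1 : E))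
  have hF : ∀ x : ({0}ᶜ : Set E), F (homeomorphUnitSphereProd E x) = f x := by
    rintro ⟨x, hx⟩
    have hx' : ‖x‖ ≠ 0 := norm_ne_zero_iff.2 hx
    simp [F, smul_smul, hx']
  have hint : Integrable F (ν.toSphere.prod (.volumeIoiPow (finrank ℝ E - 1))) := by
    rw [← hmp.integrable_comp_emb (Homeomorph.measurableEmbedding _)]
    simp only [Function.comp_def, hF]
    exact (integrableOn_iff_comap_subtypeVal (measurableSet_singleton _).compl).1 hf.integrableOn
  calc ∫ x, f x ∂ν = ∫ x : ({0}ᶜ : Set E), f x ∂(ν.comap (↑)) := by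
        rw [integral_subtype_comap (measurableSet_singleton _).compl f, restrict_compl_singleton]
    _ = ∫ p, F p ∂ν.toSphere.prod (.volumeIoiPow (finrank ℝ E - 1)) := by
        rw [← hmp.integral_comp (Homeomorph.measurableEmbedding _)]
        simp only [hF]
    _ = ∫ s : Ioi (0 : ℝ), ∫ y : sphere (0 : E) 1, f ((s : ℝ) • (y : E)) ∂ν.toSphere
          ∂.volumeIoiPow (finrank ℝ E - 1) := integral_prod_symm F hint
    _ = _ := by
        simp only [Measure.volumeIoiPow, ENNReal.ofReal]
        rw [integral_withDensity_eq_integral_smul,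
          integral_subtype_comap measurableSet_Ioi fun a ↦ Real.toNNReal (a ^ (finrank ℝ E - 1)) •
            ∫ y : sphere (0 : E) 1, f (a • (y : E)) ∂ν.toSphere,
          setIntegral_congr_fun measurableSet_Ioi fun x hx ↦ ?_]
        · simp only [NNReal.smul_def, Real.coe_toNNReal _ (pow_nonneg hx.out.le _), smul_eq_mul]
        · exact (measurable_subtype_coe.pow_const _).real_toNNReal

end Polar

/-- The area of the unit sphere. -/
noncomputable def sphereArea (m : ℕ) : ℝ :=
  (volume : Measure (EuclideanSpace ℝ (Fin m))).toSphere.real univ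

theorem sphereArea_eq (m : ℕ) :
    sphereArea m = m * (volume : Measure (EuclideanSpace ℝ (Fin m))).real (ball 0 1) := by
  simp [sphereArea]

theorem nontrivial_euclideanSpace {m : ℕ} (hm : 2 ≤ m) :
    Nontrivial (EuclideanSpace ℝ (Fin m)) := by
  have : Nonempty (Fin m) := ⟨⟨0, by omega⟩⟩
  infer_instance

theorem volume_unit_ball_pos (m : ℕ) :
    0 < (volume : Measure (EuclideanSpace ℝ (Fin m))).real (ball 0 1) :=
  ENNReal.toReal_pos (measure_ball_pos _ _ one_pos).ne' measure_ball_lt_top.ne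

theorem sphereArea_pos {m : ℕ} (hm : 2 ≤ m) : 0 < sphereArea m := by
  rw [sphereArea_eq]
  have := volume_unit_ball_pos m
  have : (0 : ℝ) < m := by exact_mod_cast (by omega : 0 < m)
  positivity

theorem integral_sphere_eq {m : ℕ} (hm : 2 ≤ m) (x : EuclideanSpace ℝ (Fin m)) (r : ℝ)
    (u : EuclideanSpace ℝ (Fin m) → ℝ) :
    ∫ y : sphere (0 : EuclideanSpace ℝ (Fin m)) 1, u (x + r • (y : EuclideanSpace ℝ (Fin m)))
      ∂(volume : Measure (EuclideanSpace ℝ (Fin m))).toSphere =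
      sphereArea m * sphericalMean x r u := by
  have := (sphereArea_pos hm).ne'
  unfold sphericalMean
  rw [← sphereArea, mul_inv_cancel_left₀ this]

theorem sphericalMean_zero {m : ℕ} (hm : 2 ≤ m) (x : EuclideanSpace ℝ (Fin m))
    (u : EuclideanSpace ℝ (Fin m) → ℝ) : sphericalMean x 0 u = u x := by
  have := (sphereArea_pos hm).ne'
  unfold sphericalMean
  simp only [zero_smul, add_zero, integral_const, smul_eq_mul]
  rw [← sphereArea, inv_mul_cancel_left₀ this]

theorem continuousOn_sphericalMean {m : ℕ} {x : EuclideanSpace ℝ (Fin m)} {R : ℝ}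
    {u : EuclideanSpace ℝ (Fin m) → ℝ} (hu : ContinuousOn u (closedBall x R)) :
    ContinuousOn (fun r => sphericalMean x r u) (Icc 0 R) := by
  unfold sphericalMean
  refine continuousOn_const.mul ?_
  have hmem : ∀ r ∈ Icc 0 R, ∀ y : sphere (0 : EuclideanSpace ℝ (Fin m)) 1,
      x + r • (y : EuclideanSpace ℝ (Fin m)) ∈ closedBall x R := by
    intro r hr y
    have hy : ‖(y : EuclideanSpace ℝ (Fin m))‖ = 1 := by simp
    simp [norm_smul, hy, abs_of_nonneg hr.1, hr.2]
  obtain ⟨C, hC⟩ := (isCompact_closedBall x R).exists_bound_of_continuousOn hu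
  refine continuousOn_of_dominated (bound := fun _ => C) ?_ ?_ (integrable_const C) ?_
  · intro r hr
    have : Continuous fun y : sphere (0 : EuclideanSpace ℝ (Fin m)) 1 =>
        u (x + r • (y : EuclideanSpace ℝ (Fin m))) :=
      hu.comp_continuous (by fun_prop) (hmem r hr)
    exact this.aestronglyMeasurable
  · exact fun r hr => ae_of_all _ fun y => hC _ (hmem r hr y)
  · exact ae_of_all _ fun y => hu.comp (by fun_prop) fun r hr => hmem r hr y

/-- The radial profile `s ↦ a°(μ s)`, extended continuously to `s = 0`. -/
noncomputable def panProfile (m : ℕ) (μ s : ℝ) : ℝ := hypLimit ((m : ℝ) / 2) (μ ^ 2 / 4 * s ^ 2)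

theorem one_le_half {m : ℕ} (hm : 2 ≤ m) : (1 : ℝ) ≤ (m : ℝ) / 2 := by
  have hm' : (2 : ℝ) ≤ m := by exact_mod_cast hm
  linarith

theorem continuous_panProfile {m : ℕ} (hm : 2 ≤ m) (μ : ℝ) : Continuous (panProfile m μ) :=
  (continuous_hypLimit (one_le_half hm)).comp (by fun_prop)

theorem panProfile_pos {m : ℕ} (hm : 2 ≤ m) (μ s : ℝ) : 0 < panProfile m μ s :=
  one_pos.trans_le (one_le_hypLimit (one_le_half hm) (by positivity))

theorem panProfile_zero {m : ℕ} (hm : 2 ≤ m) (μ : ℝ) : panProfile m μ 0 = 1 := by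
  simp [panProfile, hypLimit_zero (one_le_half hm)]

theorem aCirc_eq_panProfile {m : ℕ} (hm : 2 ≤ m) {μ r : ℝ} (hμ : 0 < μ) (hr : 0 < r) :
    aCirc m (μ * r) = panProfile m μ r := by
  rw [aCirc_eq_hypLimit hm (by positivity), panProfile]
  congr 1
  ring

theorem aBullet_mul_volume_ball {m : ℕ} (hm : 2 ≤ m) {μ r : ℝ} (hμ : 0 < μ) (hr : 0 < r)
    (x : EuclideanSpace ℝ (Fin m)) :
    aBullet m (μ * r) * (volume : Measure (EuclideanSpace ℝ (Fin m))).real (ball x r) =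
      sphereArea m * ∫ s in (0 : ℝ)..r, s ^ (m - 1) * panProfile m μ s := by
  have h := integral_pow_mul_hypLimit hm (μ ^ 2 / 4) r
  rw [intervalIntegral.integral_const_mul] at h
  have hvol : (volume : Measure (EuclideanSpace ℝ (Fin m))).real (ball x r) =
      r ^ m * (volume : Measure (EuclideanSpace ℝ (Fin m))).real (ball 0 1) := by
    have := nontrivial_euclideanSpace hm
    rw [measureReal_def, Measure.addHaar_ball _ _ hr.le, ENNReal.toReal_mul,
      ENNReal.toReal_ofReal (by positivity), finrank_euclideanSpace, Fintype.card_fin,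
      ← measureReal_def]
  rw [aBullet_eq_hypLimit (by positivity), hvol, sphereArea_eq]
  unfold panProfile
  rw [show (μ * r) ^ 2 / 4 = μ ^ 2 / 4 * r ^ 2 by ring]
  linear_combination -(volume : Measure (EuclideanSpace ℝ (Fin m))).real (ball 0 1) * h

theorem isOpen_annulus {m : ℕ} (x : EuclideanSpace ℝ (Fin m)) (r₁ r₂ : ℝ) :
    IsOpen (annulus x r₁ r₂) := by
  have hc : Continuous fun y => ‖x - y‖ := by fun_prop
  exact (isOpen_lt continuous_const hc).inter (isOpen_lt hc continuous_const)

theorem annulus_subset_closedBall {m : ℕ} (x : EuclideanSpace ℝ (Fin m)) (r₁ r₂ : ℝ) :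
    annulus x r₁ r₂ ⊆ closedBall x r₂ := by
  intro y hy
  rw [mem_closedBall, dist_eq_norm_sub']
  exact hy.2.le

theorem volume_annulus_pos {m : ℕ} (hm : 2 ≤ m) (x : EuclideanSpace ℝ (Fin m)) {r₁ r₂ : ℝ}
    (hr₁ : 0 < r₁) (hr : r₁ < r₂) : 0 < volume.real (annulus x r₁ r₂) := by
  have := nontrivial_euclideanSpace hm
  obtain ⟨v, hv⟩ := exists_norm_eq (EuclideanSpace ℝ (Fin m)) (c := (r₁ + r₂) / 2) (by linarith)
  have hne : (annulus x r₁ r₂).Nonempty := by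
    refine ⟨x - v, ?_, ?_⟩ <;> rw [sub_sub_cancel, hv] <;> linarith
  refine ENNReal.toReal_pos ((isOpen_annulus x r₁ r₂).measure_pos _ hne).ne' ?_
  exact ((measure_mono (annulus_subset_closedBall x r₁ r₂)).trans_lt
    measure_closedBall_lt_top).ne

/-- Polar coordinates for a product of a radial kernel and a function, about the point `x`. -/
theorem integral_radial_mul {m : ℕ} (hm : 2 ≤ m) {x : EuclideanSpace ℝ (Fin m)}
    {u : EuclideanSpace ℝ (Fin m) → ℝ} {k : ℝ → ℝ}
    (hint : Integrable fun y : EuclideanSpace ℝ (Fin m) => k ‖y‖ * u (x + y)) :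
    ∫ y, k ‖y‖ * u (x + y) =
      sphereArea m * ∫ s in Ioi (0 : ℝ), s ^ (m - 1) * (k s * sphericalMean x s u) := by
  have := nontrivial_euclideanSpace hm
  rw [integral_eq_integral_sphere volume hint, ← integral_const_mul]
  refine setIntegral_congr_fun measurableSet_Ioi fun s hs => ?_
  have hs' : 0 < s := hs
  have hnorm : ∀ y : sphere (0 : EuclideanSpace ℝ (Fin m)) 1,
      ‖s • (y : EuclideanSpace ℝ (Fin m))‖ = s := by
    intro y
    have hy : ‖(y : EuclideanSpace ℝ (Fin m))‖ = 1 := by simp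
    rw [norm_smul, hy, mul_one, Real.norm_of_nonneg hs'.le]
  simp only [hnorm, integral_const_mul, integral_sphere_eq hm, finrank_euclideanSpace,
    Fintype.card_fin]
  ring

theorem integral_annulus {m : ℕ} (hm : 2 ≤ m) {x : EuclideanSpace ℝ (Fin m)} {r₁ r₂ : ℝ}
    (hr₁ : 0 < r₁) (hr : r₁ < r₂) {u : EuclideanSpace ℝ (Fin m) → ℝ}
    (hu : ContinuousOn u (closedBall x r₂)) :
    ∫ y in annulus x r₁ r₂, u y =
      sphereArea m * ∫ s in r₁..r₂, s ^ (m - 1) * sphericalMean x s u := by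
  have hind : ∀ y, (Ioo r₁ r₂).indicator (fun _ => (1 : ℝ)) ‖y‖ * u (x + y) =
      (annulus x r₁ r₂).indicator u (x + y) := by
    intro y
    have hiff : x + y ∈ annulus x r₁ r₂ ↔ ‖y‖ ∈ Ioo r₁ r₂ := by simp [annulus]
    by_cases hy : ‖y‖ ∈ Ioo r₁ r₂
    · rw [indicator_of_mem hy, indicator_of_mem (hiff.2 hy), one_mul]
    · rw [indicator_of_notMem hy, indicator_of_notMem (hiff.not.2 hy), zero_mul]
  have hint : Integrable ((annulus x r₁ r₂).indicator u) :=
    (((hu.integrableOn_compact (isCompact_closedBall x r₂))).mono_set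
      (annulus_subset_closedBall x r₁ r₂)).integrable_indicator
      (isOpen_annulus x r₁ r₂).measurableSet
  have hpolar := integral_radial_mul (x := x) (u := u)
    (k := (Ioo r₁ r₂).indicator fun _ => (1 : ℝ)) hm
    (by simp only [hind]; exact hint.comp_add_left x)
  simp only [hind] at hpolar
  rw [integral_add_left_eq_self (fun y => (annulus x r₁ r₂).indicator u y) x,
    integral_indicator (isOpen_annulus x r₁ r₂).measurableSet] at hpolar
  rw [hpolar, intervalIntegral.integral_of_le hr.le, integral_Ioc_eq_integral_Ioo]
  congr 1
  have hmul : ∀ s, s ^ (m - 1) * ((Ioo r₁ r₂).indicator (fun _ => (1 : ℝ)) s *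
      sphericalMean x s u) =
      (Ioo r₁ r₂).indicator (fun s => s ^ (m - 1) * sphericalMean x s u) s := by
    intro s
    by_cases hs : s ∈ Ioo r₁ r₂ <;> simp [hs]
  simp only [hmul]
  rw [setIntegral_indicator measurableSet_Ioo,
    inter_eq_right.2 fun s hs => mem_Ioi.2 (hr₁.trans hs.1)]

/-- The sphere area and the annulus volume cancel, leaving a one-dimensional weighted mean of the
quotient of the spherical mean by the profile. -/
theorem AnnularIdentity.integral_eq {m : ℕ} (hm : 2 ≤ m) {x : EuclideanSpace ℝ (Fin m)}
    {μ r₁ r₂ r : ℝ} (hμ : 0 < μ) (hr₁ : 0 < r₁) (h12 : r₁ < r₂) (hr : 0 < r)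
    {u : EuclideanSpace ℝ (Fin m) → ℝ} (hu : ContinuousOn u (closedBall x r₂))
    (h : AnnularIdentity μ u x r₁ r₂ r) :
    ∫ s in r₁..r₂, s ^ (m - 1) * sphericalMean x s u =
      sphericalMean x r u / panProfile m μ r *
        ∫ s in r₁..r₂, s ^ (m - 1) * panProfile m μ s := by
  have hc : Continuous fun s => s ^ (m - 1) * panProfile m μ s :=
    (continuous_pow _).mul (continuous_panProfile hm μ)
  unfold AnnularIdentity volumeMean at h
  rw [aBullet_mul_volume_ball hm hμ (hr₁.trans h12), aBullet_mul_volume_ball hm hμ hr₁,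
    aCirc_eq_panProfile hm hμ hr, integral_annulus hm hr₁ h12 hu, ← mul_sub,
    intervalIntegral.integral_interval_sub_left (hc.intervalIntegrable _ _)
      (hc.intervalIntegrable _ _)] at h
  have hA := (volume_annulus_pos hm x hr₁ h12).ne'
  have hS := (sphereArea_pos hm).ne'
  have hp := (panProfile_pos hm μ r).ne'
  field_simp at h ⊢
  linear_combination h

/-- Under the annular alternatives, the spherical means are those of a panharmonic function. -/
theorem sphericalMean_eq_of_annular {m : ℕ} (hm : 2 ≤ m) {x : EuclideanSpace ℝ (Fin m)}
    {μ R : ℝ} (hμ : 0 < μ) {u : EuclideanSpace ℝ (Fin m) → ℝ}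
    (hu : ContinuousOn u (closedBall x R))
    (h : ∀ r₁ r₂ : ℝ, 0 < r₁ → r₁ < r₂ → r₂ ≤ R →
      (∀ r ∈ Ioo r₁ r₂, AnnularIdentity μ u x r₁ r₂ r) ∨
        AnnularIdentity μ u x r₁ r₂ r₁ ∨ AnnularIdentity μ u x r₁ r₂ r₂)
    {s : ℝ} (hs : 0 < s) (hsR : s ≤ R) :
    sphericalMean x s u = u x * panProfile m μ s := by
  set q : ℝ → ℝ := fun r => sphericalMean x r u / panProfile m μ r with hq
  have hg := continuous_panProfile hm μ
  have hg0 := fun r => (panProfile_pos hm μ r).ne'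
  have hqc : ContinuousOn q (Icc 0 R) :=
    (continuousOn_sphericalMean hu).div hg.continuousOn fun r _ => hg0 r
  have hmean : ∀ r₁ r₂, 0 < r₁ → r₁ < r₂ → r₂ ≤ R → ∃ r ∈ ({r₁, r₂} : Set ℝ),
      ∫ s in r₁..r₂, (s ^ (m - 1) * panProfile m μ s) * q s =
        q r * ∫ s in r₁..r₂, s ^ (m - 1) * panProfile m μ s := by
    intro r₁ r₂ h1 h12 h2
    have hu2 := hu.mono (closedBall_subset_closedBall h2)
    have hmul : ∀ s, (s ^ (m - 1) * panProfile m μ s) * q s =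
        s ^ (m - 1) * sphericalMean x s u := by
      intro s
      rw [mul_assoc, hq, mul_div_cancel₀ _ (hg0 s)]
    simp only [hmul]
    rcases h r₁ r₂ h1 h12 h2 with hi | hi | hi
    · refine ⟨r₁, by simp, ?_⟩
      -- Both sides are continuous in r on [r₁, r₂], so the identity on the open interval extends to
      -- r₁.
      have heq : EqOn (fun _ => ∫ s in r₁..r₂, s ^ (m - 1) * sphericalMean x s u)
          (fun r => q r * ∫ s in r₁..r₂, s ^ (m - 1) * panProfile m μ s) (Ioo r₁ r₂) :=
        fun r hr => (hi r hr).integral_eq hm hμ h1 h12 (h1.trans hr.1) hu2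
      exact heq.of_subset_closure continuousOn_const
        ((hqc.mono (Icc_subset_Icc h1.le h2)).mul continuousOn_const) Ioo_subset_Icc_self
        (closure_Ioo h12.ne).ge (left_mem_Icc.2 h12.le)
    · exact ⟨r₁, by simp, hi.integral_eq hm hμ h1 h12 h1 hu2⟩
    · exact ⟨r₂, by simp, hi.integral_eq hm hμ h1 h12 (h1.trans h12) hu2⟩
  have hconst : ∀ r ∈ Ioo 0 s, q r = q s := by
    intro r hr
    refine eq_of_weighted_mean_eq (w := fun s => s ^ (m - 1) * panProfile m μ s) hr.2.le
      (hqc.mono (Icc_subset_Icc hr.1.le hsR)) ((continuous_pow _).mul hg).continuousOn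
      (fun t ht => ?_) fun r₁ r₂ h1 h12 h2 =>
        hmean r₁ r₂ (hr.1.trans_le h1) h12 (h2.trans hsR)
    have : 0 < t := hr.1.trans_le ht.1
    have := panProfile_pos hm μ t
    positivity
  -- Annuli require r₁ > 0, so the value at 0 is reached only as a limit.
  have h0 : q 0 = q s :=
    EqOn.of_subset_closure (g := fun _ => q s) hconst (hqc.mono (Icc_subset_Icc_right hsR))
      continuousOn_const Ioo_subset_Icc_self (closure_Ioo hs.ne).ge (left_mem_Icc.2 hs.le)
  simp only [hq, sphericalMean_zero hm, panProfile_zero hm, div_one] at h0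
  rw [h0, div_mul_cancel₀ _ (hg0 s)]

/-- Radial averages of a function with panharmonic spherical means. -/
theorem integral_radial_eq {m : ℕ} (hm : 2 ≤ m) {x : EuclideanSpace ℝ (Fin m)}
    {μ R : ℝ} {u : EuclideanSpace ℝ (Fin m) → ℝ}
    (h : ∀ s, 0 < s → s ≤ R → sphericalMean x s u = u x * panProfile m μ s)
    {k : ℝ → ℝ} (hk : ∀ s, R < s → k s = 0)
    (hi : Integrable fun y : EuclideanSpace ℝ (Fin m) => k ‖y‖ * u (x + y)) :
    ∫ y, k ‖y‖ * u (x + y) =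
      u x * ∫ y : EuclideanSpace ℝ (Fin m), k ‖y‖ * panProfile m μ ‖y‖ := by
  have h1 := integral_radial_mul hm hi
  have := nontrivial_euclideanSpace hm
  have h2 := integral_fun_norm_addHaar (volume : Measure (EuclideanSpace ℝ (Fin m)))
    fun s => k s * panProfile m μ s
  rw [h1, h2]
  simp only [finrank_euclideanSpace, Fintype.card_fin, nsmul_eq_mul, smul_eq_mul]
  rw [← mul_assoc (m : ℝ), ← sphereArea_eq, mul_left_comm]
  congr 1
  rw [← integral_const_mul]
  refine setIntegral_congr_fun measurableSet_Ioi fun s hs => ?_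
  rw [mem_Ioi] at hs
  rcases le_or_gt s R with hsR | hsR
  · simp only [h s hs hsR]
    ring
  · simp [hk s hsR]

end SphericalMeans

/-! ### Smoothness by mollification. -/

section Smoothness

open MeasureTheory Set Metric Module

/-- A function whose small spherical means are those of a panharmonic function is a multiple of
its own mollification, hence smooth. -/
theorem contDiffAt_of_sphericalMean {m : ℕ} (hm : 2 ≤ m) {x₀ : EuclideanSpace ℝ (Fin m)}
    {μ ρ : ℝ} (hρ : 0 < ρ) {u : EuclideanSpace ℝ (Fin m) → ℝ}
    (hu : ContinuousOn u (closedBall x₀ (2 * ρ)))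
    (h : ∀ x ∈ ball x₀ ρ, ∀ s, 0 < s → s ≤ ρ →
      sphericalMean x s u = u x * panProfile m μ s) :
    ContDiffAt ℝ 2 u x₀ := by
  set k : ℝ → ℝ := fun s => expNegInvGlue (ρ ^ 2 - s ^ 2) with hk
  set ψ : EuclideanSpace ℝ (Fin m) → ℝ := fun y => k ‖y‖ with hψ
  -- The cutoff makes u globally integrable. Radius 2ρ suffices: x lies within ρ of x₀ and the
  -- kernel vanishes beyond ρ.
  set v : EuclideanSpace ℝ (Fin m) → ℝ := (closedBall x₀ (2 * ρ)).indicator u with hv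
  have hk0 : ∀ s, ρ < s → k s = 0 := fun s hs =>
    expNegInvGlue.zero_of_nonpos (by nlinarith)
  have hψd : ContDiff ℝ 2 ψ :=
    (expNegInvGlue.contDiff (n := 2)).comp (contDiff_const.sub (contDiff_norm_sq ℝ))
  have hψs : HasCompactSupport ψ := by
    refine HasCompactSupport.intro (isCompact_closedBall (0 : EuclideanSpace ℝ (Fin m)) ρ)
      fun y hy => hk0 _ ?_
    simpa using hy
  have hvi : Integrable v :=
    (hu.integrableOn_compact (isCompact_closedBall _ _)).integrable_indicator
      measurableSet_closedBall
  obtain ⟨C, hC⟩ := hψs.exists_bound_of_continuous hψd.continuous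
  have hg := continuous_panProfile hm μ
  have hpos : 0 < ∫ y, ψ y * panProfile m μ ‖y‖ := by
    have hcont : Continuous fun y => ψ y * panProfile m μ ‖y‖ :=
      hψd.continuous.mul (hg.comp continuous_norm)
    refine hcont.integral_pos_of_hasCompactSupport_nonneg_nonzero (x := 0) hψs.mul_right
      (fun y => mul_nonneg (expNegInvGlue.nonneg _) (panProfile_pos hm μ _).le) ?_
    refine (mul_pos (expNegInvGlue.pos_of_pos ?_) (panProfile_pos hm μ _)).ne'
    simp [hρ]
  have hsm : ContDiff ℝ 2 (convolution ψ v (ContinuousLinearMap.lsmul ℝ ℝ) volume) :=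
    hψs.contDiff_convolution_left _ (n := 2) hψd hvi.locallyIntegrable
  have heq : ∀ x ∈ ball x₀ ρ, u x = (∫ y, ψ y * panProfile m μ ‖y‖)⁻¹ *
      convolution ψ v (ContinuousLinearMap.lsmul ℝ ℝ) volume x := by
    intro x hx
    have huv : ∀ y, ψ y * v (x + y) = k ‖y‖ * u (x + y) := by
      intro y
      rcases le_or_gt ‖y‖ ρ with hy | hy
      · have : x + y ∈ closedBall x₀ (2 * ρ) := by
          rw [mem_closedBall, dist_eq_norm]
          rw [mem_ball, dist_eq_norm] at hx
          calc ‖x + y - x₀‖ = ‖(x - x₀) + y‖ := by congr 1; abel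
            _ ≤ ‖x - x₀‖ + ‖y‖ := norm_add_le _ _
            _ ≤ 2 * ρ := by linarith
        rw [hv, indicator_of_mem this]
      · simp [hψ, hk0 _ hy]
    have hi : Integrable fun y => ψ y * v (x + y) :=
      (hvi.comp_add_left x).bdd_mul hψd.continuous.aestronglyMeasurable (ae_of_all _ hC)
    have hconv : convolution ψ v (ContinuousLinearMap.lsmul ℝ ℝ) volume x =
        ∫ y, k ‖y‖ * u (x + y) := by
      -- The convolution samples v at x - y; the kernel is even, so y can be replaced by -y.
      rw [convolution_lsmul, ← integral_neg_eq_self]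
      refine integral_congr_ae (ae_of_all _ fun y => ?_)
      simp only [smul_eq_mul, sub_neg_eq_add, ← huv, hψ, norm_neg]
    simp only [huv] at hi
    rw [hconv, integral_radial_eq hm (h x hx) hk0 hi, eq_inv_mul_iff_mul_eq₀ hpos.ne', mul_comm]
  refine (contDiff_const.mul hsm).contDiffAt.congr_of_eventuallyEq
    (f := fun x => (∫ y, ψ y * panProfile m μ ‖y‖)⁻¹ *
      convolution ψ v (ContinuousLinearMap.lsmul ℝ ℝ) volume x) ?_
  filter_upwards [ball_mem_nhds x₀ hρ] with x hx using heq x hx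

end Smoothness

/-! ### Second-order expansions and the Laplacian. -/

section Expansion

open MeasureTheory Set Metric Module Filter Topology Asymptotics

/-- Second order Taylor expansion with Peano remainder. -/
theorem taylor_two_isLittleO {E : Type*} [NormedAddCommGroup E] [NormedSpace ℝ E] {u : E → ℝ}
    {x : E} (hu : ContDiffAt ℝ 2 u x) :
    (fun y => u (x + y) - u x - fderiv ℝ u x y - 1 / 2 * fderiv ℝ (fderiv ℝ u) x y y)
      =o[𝓝 0] fun y => ‖y‖ ^ 2 := by
  set B := fderiv ℝ (fderiv ℝ u) x with hB
  have hsymm : ∀ v w, B v w = B w v := hu.isSymmSndFDerivAt (by simp)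
  have hd : HasFDerivAt (fderiv ℝ u) B x :=
    ((hu.fderiv_right (m := 1) (by norm_num)).differentiableAt one_ne_zero).hasFDerivAt
  have hev : ∀ᶠ z in 𝓝 x, DifferentiableAt ℝ u z :=
    (hu.eventually (by simp)).mono fun z hz => hz.differentiableAt two_ne_zero
  have htend : Tendsto (fun y : E => x + y) (𝓝 0) (𝓝 x) := by
    have : ContinuousAt (fun y : E => x + y) 0 := by fun_prop
    simpa [ContinuousAt] using this
  rw [hasFDerivAt_iff_isLittleO_nhds_zero] at hd
  rw [isLittleO_iff]
  intro ε hε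
  obtain ⟨δ, hδ, hball⟩ := Metric.eventually_nhds_iff_ball.1
    ((htend.eventually hev).and (hd.def hε))
  filter_upwards [ball_mem_nhds (0 : E) hδ] with y hy
  have hsub : ∀ z ∈ closedBall (0 : E) ‖y‖, z ∈ ball (0 : E) δ := by
    intro z hz
    simp only [mem_ball, mem_closedBall, dist_zero_right] at *
    exact hz.trans_lt hy
  have hder : ∀ z ∈ closedBall (0 : E) ‖y‖, HasFDerivWithinAt
      (fun y => u (x + y) - u x - fderiv ℝ u x y - 1 / 2 * B y y)
      (fderiv ℝ u (x + z) - fderiv ℝ u x - B z) (closedBall 0 ‖y‖) z := by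
    intro z hz
    have h1 : HasFDerivAt (fun y => u (x + y)) (fderiv ℝ u (x + z)) z :=
      (hasFDerivAt_comp_add_left x).2 (hball z (hsub z hz)).1.hasFDerivAt
    have h2 : HasFDerivAt (fun y => B y y) (B z + B.flip z) z := by
      exact B.hasFDerivAt.clm_apply (hasFDerivAt_id z)
    have h3 := ((h1.sub_const (u x)).sub (fderiv ℝ u x).hasFDerivAt).sub (h2.const_mul (1 / 2))
    -- Symmetry of B turns the derivative of B y y / 2 into B z. The remainder's derivative is then
    -- o(‖z‖), and the mean value inequality gives o(‖y‖²).
    refine (h3.congr_fderiv ?_).hasFDerivWithinAt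
    ext w
    simp [hsymm w z]
    ring
  have hmv := (convex_closedBall (0 : E) ‖y‖).norm_image_sub_le_of_norm_hasFDerivWithin_le
    (C := ε * ‖y‖) hder (fun z hz => ?_) (mem_closedBall_self (norm_nonneg y))
    (by simp : y ∈ closedBall (0 : E) ‖y‖)
  · simpa [pow_two, mul_assoc] using hmv
  · refine (hball z (hsub z hz)).2.trans ?_
    have : ‖z‖ ≤ ‖y‖ := by simpa using hz
    gcongr

/-- The linear coefficient 1/c of ₀F₁ at c = m/2, times μ²/4, is μ²/(2m). -/
theorem panProfile_isLittleO {m : ℕ} (hm : 2 ≤ m) (μ : ℝ) :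
    (fun y : EuclideanSpace ℝ (Fin m) =>
      panProfile m μ ‖y‖ - 1 - μ ^ 2 / (2 * m) * ‖y‖ ^ 2) =o[𝓝 0] fun y => ‖y‖ ^ 2 := by
  have hcont : Continuous fun y : EuclideanSpace ℝ (Fin m) => μ ^ 2 / 4 * ‖y‖ ^ 2 := by fun_prop
  have hz : ∀ᶠ y : EuclideanSpace ℝ (Fin m) in 𝓝 0, μ ^ 2 / 4 * ‖y‖ ^ 2 < 1 :=
    hcont.tendsto' 0 0 (by simp) |>.eventually (gt_mem_nhds one_pos)
  have hO : (fun y : EuclideanSpace ℝ (Fin m) =>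
      panProfile m μ ‖y‖ - 1 - μ ^ 2 / (2 * m) * ‖y‖ ^ 2) =O[𝓝 0] fun y => ‖y‖ ^ 4 := by
    refine IsBigO.of_bound (Real.exp 1 * (μ ^ 2 / 4) ^ 2) ?_
    filter_upwards [hz] with y hy
    have h := abs_hypLimit_sub_le (one_le_half hm)
      (by positivity : 0 ≤ μ ^ 2 / 4 * ‖y‖ ^ 2) hy.le
    have hm0 : (m : ℝ) ≠ 0 := by
      have := one_le_half hm
      intro h0
      norm_num [h0] at this
    have he : μ ^ 2 / 4 * ‖y‖ ^ 2 / ((m : ℝ) / 2) = μ ^ 2 / (2 * m) * ‖y‖ ^ 2 := by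
      field_simp
      ring
    rw [he] at h
    rw [Real.norm_eq_abs, norm_pow, norm_norm]
    refine h.trans (le_of_eq ?_)
    ring
  refine hO.trans_isLittleO ?_
  exact (isLittleO_pow_pow (𝕜 := ℝ) (by norm_num : 2 < 4)).comp_tendsto tendsto_norm_zero

/-! ### Moments of the ball from its orthogonal symmetries. -/

section Moments

variable {m : ℕ}

theorem setIntegral_closedBall_comp_isometry
    (T : EuclideanSpace ℝ (Fin m) ≃ₗᵢ[ℝ] EuclideanSpace ℝ (Fin m)) (r : ℝ)
    (f : EuclideanSpace ℝ (Fin m) → ℝ) :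
    ∫ y in closedBall 0 r, f (T y) = ∫ y in closedBall 0 r, f y := by
  have h := T.measurePreserving.setIntegral_preimage_emb
    T.toHomeomorph.measurableEmbedding f (closedBall 0 r)
  rwa [show T ⁻¹' closedBall 0 r = closedBall 0 r by ext y; simp] at h

theorem setIntegral_closedBall_linear (L : EuclideanSpace ℝ (Fin m) →L[ℝ] ℝ) (r : ℝ) :
    ∫ y in closedBall 0 r, L y = 0 := by
  have h := setIntegral_closedBall_comp_isometry (LinearIsometryEquiv.neg ℝ) r L
  simp only [LinearIsometryEquiv.coe_neg, map_neg, integral_neg] at h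
  linarith

theorem setIntegral_closedBall_coord_mul {i j : Fin m} (hij : i ≠ j) (r : ℝ) :
    ∫ y : EuclideanSpace ℝ (Fin m) in closedBall 0 r, y i * y j = 0 := by
  have h := setIntegral_closedBall_comp_isometry
    (LinearIsometryEquiv.piLpCongrRight 2 fun l : Fin m =>
      if l = i then LinearIsometryEquiv.neg ℝ (E := ℝ) else LinearIsometryEquiv.refl ℝ ℝ) r
    fun y => y i * y j
  simp [hij.symm, integral_neg] at h
  linarith

theorem setIntegral_closedBall_coord_sq (i j : Fin m) (r : ℝ) :
    ∫ y : EuclideanSpace ℝ (Fin m) in closedBall 0 r, y i * y i =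
      ∫ y : EuclideanSpace ℝ (Fin m) in closedBall 0 r, y j * y j := by
  have h := setIntegral_closedBall_comp_isometry
    (LinearIsometryEquiv.piLpCongrLeft 2 ℝ ℝ (Equiv.swap i j)) r fun y => y i * y i
  rw [← h]
  simp [LinearIsometryEquiv.piLpCongrLeft_apply]

theorem integrableOn_closedBall_of_continuous {f : EuclideanSpace ℝ (Fin m) → ℝ}
    (hf : Continuous f) (r : ℝ) : IntegrableOn f (closedBall 0 r) :=
  hf.continuousOn.integrableOn_compact (isCompact_closedBall _ _)

theorem setIntegral_closedBall_coord_sq_eq (i : Fin m) (r : ℝ) :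
    (m : ℝ) * ∫ y : EuclideanSpace ℝ (Fin m) in closedBall 0 r, y i * y i =
      ∫ y : EuclideanSpace ℝ (Fin m) in closedBall 0 r, ‖y‖ ^ 2 := by
  simp only [EuclideanSpace.real_norm_sq_eq]
  simp only [pow_two]
  rw [integral_finsetSum _ fun j _ => integrableOn_closedBall_of_continuous (by fun_prop) r,
    Finset.sum_congr rfl fun j _ => setIntegral_closedBall_coord_sq j i r]
  simp

/-- Off-diagonal terms vanish by reflecting one coordinate; the diagonal moments agree by swapping
coordinates, so only the trace of B survives. -/
theorem setIntegral_closedBall_bilinear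
    (B : EuclideanSpace ℝ (Fin m) →L[ℝ] EuclideanSpace ℝ (Fin m) →L[ℝ] ℝ) (r : ℝ) :
    (m : ℝ) * ∫ y in closedBall 0 r, B y y =
      (∑ i, B (EuclideanSpace.basisFun (Fin m) ℝ i) (EuclideanSpace.basisFun (Fin m) ℝ i)) *
        ∫ y : EuclideanSpace ℝ (Fin m) in closedBall 0 r, ‖y‖ ^ 2 := by
  set e := EuclideanSpace.basisFun (Fin m) ℝ with he
  have hexp : ∀ y, B y y = ∑ i, ∑ j, y i * y j * B (e i) (e j) := by
    intro y
    have hy : y = ∑ i, y i • e i := by simpa [he] using (e.sum_repr y).symm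
    conv_lhs => rw [hy]
    simp only [map_sum, map_smul, _root_.sum_apply, _root_.smul_apply,
      smul_eq_mul, Finset.mul_sum]
    rw [Finset.sum_comm]
    refine Finset.sum_congr rfl fun i _ => Finset.sum_congr rfl fun j _ => ?_
    ring
  rw [integral_congr_ae (ae_of_all _ hexp), integral_finsetSum _ fun i _ => integrableOn_closedBall_of_continuous (by fun_prop) r,
    Finset.mul_sum, Finset.sum_mul]
  refine Finset.sum_congr rfl fun i _ => ?_
  rw [integral_finsetSum _ fun j _ => integrableOn_closedBall_of_continuous (by fun_prop) r,
    Finset.sum_eq_single i]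
  · rw [integral_mul_const, ← setIntegral_closedBall_coord_sq_eq i r]
    ring
  · intro j _ hj
    rw [integral_mul_const, setIntegral_closedBall_coord_mul hj.symm, zero_mul]
  · simp

theorem setIntegral_closedBall_norm_sq_pos (hm : 2 ≤ m) {r : ℝ} (hr : 0 < r) :
    0 < ∫ y : EuclideanSpace ℝ (Fin m) in closedBall 0 r, ‖y‖ ^ 2 := by
  have := nontrivial_euclideanSpace hm
  rw [setIntegral_pos_iff_support_of_nonneg_ae (ae_of_all _ fun y => by positivity)
    (integrableOn_closedBall_of_continuous (by fun_prop) r)]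
  have hsupp : (Function.support fun y : EuclideanSpace ℝ (Fin m) => ‖y‖ ^ 2) = {0}ᶜ := by
    ext y
    simp
  rw [hsupp, inter_comm, ← sdiff_eq, measure_sdiff_null (measure_singleton _)]
  exact measure_closedBall_pos _ _ hr

end Moments

/-- A `C²` function with panharmonic spherical means solves `Δu = μ²u`. -/
theorem laplacian_eq_of_sphericalMean {m : ℕ} (hm : 2 ≤ m) {x : EuclideanSpace ℝ (Fin m)}
    {μ R : ℝ} (hR : 0 < R) {u : EuclideanSpace ℝ (Fin m) → ℝ}
    (hu : ContinuousOn u (closedBall x R)) (hu2 : ContDiffAt ℝ 2 u x)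
    (h : ∀ s, 0 < s → s ≤ R → sphericalMean x s u = u x * panProfile m μ s) :
    Laplacian.laplacian u x - μ ^ 2 * u x = 0 := by
  set B := fderiv ℝ (fderiv ℝ u) x with hB
  have hlap : Laplacian.laplacian u x =
      ∑ i, B (EuclideanSpace.basisFun (Fin m) ℝ i) (EuclideanSpace.basisFun (Fin m) ℝ i) := by
    rw [InnerProductSpace.laplacian_eq_iteratedFDeriv_orthonormalBasis u
      (EuclideanSpace.basisFun (Fin m) ℝ)]
    simp [iteratedFDeriv_two_apply, hB]
  have hm0 : (0 : ℝ) < m := by exact_mod_cast (by omega : 0 < m)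
  -- P is the Taylor remainder of u minus u x times that of the profile. It is o(‖y‖²), yet its
  -- integral over each small ball is a fixed multiple of ∫ ‖y‖², so that multiple must be 0.
  set P : EuclideanSpace ℝ (Fin m) → ℝ := fun y =>
    (u (x + y) - u x - fderiv ℝ u x y - 1 / 2 * B y y) -
      u x * (panProfile m μ ‖y‖ - 1 - μ ^ 2 / (2 * m) * ‖y‖ ^ 2) with hP
  have hPo : P =o[𝓝 0] fun y => ‖y‖ ^ 2 :=
    (taylor_two_isLittleO hu2).sub ((panProfile_isLittleO hm μ).const_mul_left (u x))
  have hPint : ∀ r, 0 < r → r ≤ R → ∫ y in closedBall 0 r, P y =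
      -((Laplacian.laplacian u x - μ ^ 2 * u x) / (2 * m)) *
        ∫ y : EuclideanSpace ℝ (Fin m) in closedBall 0 r, ‖y‖ ^ 2 := by
    intro r hr hrR
    have hmaps : MapsTo (fun y => x + y) (closedBall 0 r) (closedBall x R) := by
      intro y hy
      have : ‖y‖ ≤ r := by simpa using hy
      simpa using this.trans hrR
    have hui : IntegrableOn (fun y => u (x + y)) (closedBall 0 r) :=
      (hu.comp (by fun_prop) hmaps).integrableOn_compact (isCompact_closedBall _ _)
    have hgc : Continuous fun y : EuclideanSpace ℝ (Fin m) => panProfile m μ ‖y‖ :=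
      (continuous_panProfile hm μ).comp continuous_norm
    have hind : ∀ f : EuclideanSpace ℝ (Fin m) → ℝ, ∀ y,
        (Iic r).indicator (fun _ => (1 : ℝ)) ‖y‖ * f y = (closedBall 0 r).indicator f y := by
      intro f y
      by_cases hy : ‖y‖ ≤ r <;> simp [indicator, hy]
    have hrad := integral_radial_eq hm (R := r) (fun s hs hsr => h s hs (hsr.trans hrR))
      (k := (Iic r).indicator fun _ => (1 : ℝ)) (fun s hs => by simp [hs]) (by
        simp only [hind fun y => u (x + y)]
        exact hui.integrable_indicator measurableSet_closedBall)
    simp only [hind fun y => u (x + y), hind fun y => panProfile m μ ‖y‖,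
      integral_indicator measurableSet_closedBall] at hrad
    have hsplit : ∀ y, P y = u (x + y) - u x * panProfile m μ ‖y‖ - fderiv ℝ u x y -
        1 / 2 * B y y + u x * μ ^ 2 / (2 * m) * ‖y‖ ^ 2 := by
      intro y
      simp only [hP]
      ring
    have hgi := integrableOn_closedBall_of_continuous (hgc.const_mul (u x)) r
    have hLi := integrableOn_closedBall_of_continuous (fderiv ℝ u x).continuous r
    have hBi := integrableOn_closedBall_of_continuous
      (by fun_prop : Continuous fun y => 1 / 2 * B y y) r
    have hNi := integrableOn_closedBall_of_continuous
      (by fun_prop : Continuous fun y : EuclideanSpace ℝ (Fin m) =>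
        u x * μ ^ 2 / (2 * m) * ‖y‖ ^ 2) r
    simp only [hsplit]
    have h₂ : IntegrableOn (fun y => u (x + y) - u x * panProfile m μ ‖y‖) (closedBall 0 r) :=
      hui.sub hgi
    have h₃ : IntegrableOn (fun y => u (x + y) - u x * panProfile m μ ‖y‖ - fderiv ℝ u x y)
      (closedBall 0 r) := h₂.sub hLi
    have h₄ : IntegrableOn (fun y => u (x + y) - u x * panProfile m μ ‖y‖ - fderiv ℝ u x y -
      1 / 2 * B y y) (closedBall 0 r) := h₃.sub hBi
    rw [integral_add h₄ hNi, integral_sub h₃ hBi, integral_sub h₂ hLi, integral_sub hui hgi, integral_const_mul, integral_const_mul, integral_const_mul, hrad,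
      setIntegral_closedBall_linear, hlap]
    have hb := setIntegral_closedBall_bilinear B r
    field_simp
    linear_combination -hb
  have hsmall : ∀ ε > 0, |(Laplacian.laplacian u x - μ ^ 2 * u x) / (2 * m)| ≤ ε := by
    intro ε hε
    obtain ⟨δ, hδ, hball⟩ := Metric.eventually_nhds_iff_ball.1 (hPo.def hε)
    set r := min R (δ / 2) with hr
    have hr0 : 0 < r := by positivity
    have hE := setIntegral_closedBall_norm_sq_pos hm hr0
    have hle : ‖∫ y in closedBall 0 r, P y‖ ≤
        ∫ y : EuclideanSpace ℝ (Fin m) in closedBall 0 r, ε * ‖y‖ ^ 2 := by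
      refine norm_integral_le_of_norm_le
        (integrableOn_closedBall_of_continuous (by fun_prop) r) ?_
      filter_upwards [ae_restrict_mem measurableSet_closedBall] with y hy
      have hy' : ‖y‖ ≤ r := by simpa using hy
      have hrδ : r ≤ δ / 2 := min_le_right _ _
      simpa using hball y (by rw [mem_ball, dist_zero_right]; linarith)
    rw [hPint r hr0 (min_le_left _ _), integral_const_mul, norm_mul, norm_neg,
      Real.norm_eq_abs, Real.norm_of_nonneg hE.le] at hle
    exact le_of_mul_le_mul_right hle hE
  have hzero : (Laplacian.laplacian u x - μ ^ 2 * u x) / (2 * m) = 0 :=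
    abs_nonpos_iff.1 (le_of_forall_pos_le_add fun ε hε => by simpa using hsmall ε hε)
  rcases div_eq_zero_iff.1 hzero with h0 | h0
  · exact h0
  · exact absurd h0 (by positivity)

end Expansion

/-! ### The main theorem. -/

open MeasureTheory Set Metric

theorem theorem4p3 {m : ℕ} (hm : 2 ≤ m) (D : Set (EuclideanSpace ℝ (Fin m)))
    (hD_open : IsOpen D) (hD_conn : IsConnected D) (hD_bdd : Bornology.IsBounded D)
    (μ : ℝ) (hμ : 0 < μ) (u : EuclideanSpace ℝ (Fin m) → ℝ) (hu : ContinuousOn u D)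
    (h : ∀ x ∈ D, ∀ r₁ r₂ : ℝ, 0 < r₁ → r₁ < r₂ → AdmissibleBall D x r₂ →
      (∀ r ∈ Set.Ioo r₁ r₂, AnnularIdentity μ u x r₁ r₂ r) ∨
        AnnularIdentity μ u x r₁ r₂ r₁ ∨ AnnularIdentity μ u x r₁ r₂ r₂) :
    PanharmonicOn μ u D := by
  have hmean : ∀ x R, 0 < R → closedBall x R ⊆ D → ∀ s, 0 < s → s ≤ R →
      sphericalMean x s u = u x * panProfile m μ s := by
    intro x R hR hsub s hs hsR
    refine sphericalMean_eq_of_annular hm hμ (hu.mono hsub) (fun r₁ r₂ h1 h12 h2 => ?_) hs hsR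
    exact h x (hsub (mem_closedBall_self hR.le)) r₁ r₂ h1 h12
      (closure_ball_subset_closedBall.trans ((closedBall_subset_closedBall h2).trans hsub))
  have hdiff : ∀ x ∈ D, ContDiffAt ℝ 2 u x := by
    intro x hx
    obtain ⟨R, hR, hsub⟩ := Metric.nhds_basis_closedBall.mem_iff.1 (hD_open.mem_nhds hx)
    -- Halving R keeps every ball of radius R / 2 centred within R / 2 of x inside D.
    have h2 : 2 * (R / 2) = R := by ring
    refine contDiffAt_of_sphericalMean hm (half_pos hR) (hu.mono (by rwa [h2]))
      fun y hy => hmean y (R / 2) (half_pos hR) (subset_trans ?_ hsub)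
    refine closedBall_subset_closedBall' ?_
    have := (mem_ball.1 hy).le
    linarith
  refine ⟨fun x hx => (hdiff x hx).contDiffWithinAt, fun x hx => ?_⟩
  obtain ⟨R, hR, hsub⟩ := Metric.nhds_basis_closedBall.mem_iff.1 (hD_open.mem_nhds hx)
  exact laplacian_eq_of_sphericalMean hm hR (hu.mono hsub) (hdiff x hx) (hmean x R hR hsub)
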